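/- Work over $\mathbb{C}$. Let $d\ge 3$ and let $C\subset\mathbb{P}^2$ be the union of $d$ distinct lines. The multiplicity of $C$ at a point is the number of these lines passing through it. Suppose that $C$ is of type $(d;\,d-2,\,3,\,2^{2(d-3)})$, that is, there are pairwise distinct points $P_0,P_1,Q_1,\dots,Q_{2(d-3)}$ of $\mathbb{P}^2$, among which are all the singular points of $C$ (the points lying on at least two of the lines), such that $C$ has multiplicity exactly $d-2$ at $P_0$, exactly $3$ at $P_1$, and exactly $2$ at each $Q_j$. Then $C$ is Cremona contractible (Cr-contractible): there is a Cremona transformation $\gamma\colon\mathbb{P}^2\dashrightarrow\mathbb{P}^2$ (a birational map) that contracts $C$ to a finite set of points, i.e. the set of values of $\gamma$ at the points of $C$ where $\gamma$ is defined is finite; equivalently, $\gamma$ is constant on each of the $d$ lines. -/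

import Mathlib

/-- The complex projective plane. -/
abbrev PPlane : Type := Projectivization ℂ (Fin 3 → ℂ)

/-- A line of the projective plane: the set of all points `[x₀, x₁, x₂]` with
`a₀ x₀ + a₁ x₁ + a₂ x₂ = 0`, for some `[a₀, a₁, a₂]`. -/
def IsProjLine (L : Set PPlane) : Prop :=
  ∃ A : PPlane, L = {P : PPlane | Projectivization.orthogonal A P}

/-- A rational map from the plane to itself, `[x] ⇢ [F₀(x), F₁(x), F₂(x)]`, written with forms
`F₀, F₁, F₂` of one and the same degree and without non-constant common factor (in particular
not all zero); such forms are unique up to a common scalar factor. -/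
structure PlaneRationalMap where
  degree : ℕ
  form : Fin 3 → MvPolynomial (Fin 3) ℂ
  isHomogeneous : ∀ i, (form i).IsHomogeneous degree
  isUnit_of_dvd : ∀ g : MvPolynomial (Fin 3) ℂ, (∀ i, g ∣ form i) → IsUnit g

namespace PlaneRationalMap

/-- The values of the three defining forms at a vector of homogeneous coordinates. -/
noncomputable def coords (γ : PlaneRationalMap) (x : Fin 3 → ℂ) : Fin 3 → ℂ :=
  fun i => MvPolynomial.eval x (γ.form i)

/-- The set of the values of `γ` at the points of `Z` at which `γ` is defined, that is, at which
the three forms do not all vanish. -/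
def image (γ : PlaneRationalMap) (Z : Set PPlane) : Set PPlane :=
  {Q | ∃ (x : Fin 3 → ℂ) (hx : x ≠ 0) (hγ : γ.coords x ≠ 0),
    Projectivization.mk ℂ x hx ∈ Z ∧ Q = Projectivization.mk ℂ (γ.coords x) hγ}

/-- `δ ∘ γ` is the identity as a rational map: substituting the forms of `γ` into those of `δ`
gives `(H x₀, H x₁, H x₂)` with a nonzero polynomial `H`. -/
def CompEqId (δ γ : PlaneRationalMap) : Prop :=
  ∃ H : MvPolynomial (Fin 3) ℂ, H ≠ 0 ∧
    ∀ i, MvPolynomial.bind₁ γ.form (δ.form i) = H * MvPolynomial.X i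

/-- A Cremona transformation of the plane: a birational self-map. -/
def IsCremona (γ : PlaneRationalMap) : Prop :=
  ∃ δ : PlaneRationalMap, CompEqId δ γ ∧ CompEqId γ δ

end PlaneRationalMap

/-- A plane curve `C` (given by its set of points) is Cremona contractible if some Cremona
transformation contracts it to a finite set of points. As the indeterminacy points of a rational
map of the plane are finite in number, this says that the transformation is constant on each
irreducible component of `C`. -/
def IsCrContractible (C : Set PPlane) : Prop :=
  ∃ γ : PlaneRationalMap, γ.IsCremona ∧ (γ.image C).Finite

/-- The multiplicity at `P` of the union of a set of distinct lines: the number of those lines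
that pass through `P`. -/
noncomputable def lineMult (S : Finset (Set PPlane)) (P : PPlane) : ℕ :=
  Set.ncard {L : Set PPlane | L ∈ S ∧ P ∈ L}

/-- The union of the distinct lines in `S` is of type `(d; m₀, …, m_r)`: there are `d` lines, and
there are distinct points `P₀, …, P_r`, at which the union has multiplicities exactly
`m₀, …, m_r`, that comprise all its singular points. (Distinct lines have distinct tangent
directions, so there are no infinitely near singular points.) -/
def HasLineType (S : Finset (Set PPlane)) (d : ℕ) (m : List ℕ) : Prop :=
  S.card = d ∧ ∃ P : Fin m.length → PPlane, Function.Injective P ∧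
    (∀ i, lineMult S (P i) = m.get i) ∧
    ∀ Q : PPlane, 2 ≤ lineMult S Q → ∃ i, P i = Q

/-! Exactly two lines A, B of C avoid P₀. At most one of the three lines through P₁ contains P₀, so
A and B both pass through P₁. Take coordinates with P₀ = [0,1,0], P₁ = [1,0,0], A: x₁ = 0, B: x₁ =
x₂; the other lines are x₀ = c x₂ or x₂ = 0. With f(x) = ∏ (x - c) in the chart x₂ = 1, the de
Jonquières map (x, y) ↦ (x, u), u = f(x) y/(y - 1), preserves the pencil at P₀, sends A and the
lines x = c into u = 0, and sends B to u = ∞. Following it by (x, u) ↦ (x/u, u) contracts u = 0 to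
[1,0,0] and u = ∞ to [0,1,0]; the line x₂ = 0 also goes to [0,1,0]. This is `contraction`;
`isCrContractible_of_pencil` supplies the coordinates. -/

section Contraction

open MvPolynomial

/-! ### Binary forms and coprimality -/

/-- The binary form `∏ (a - c b)`, the product being over the elements `c` of `s`. -/
noncomputable def pencilForm (s : Multiset ℂ) (a b : MvPolynomial (Fin 3) ℂ) :
    MvPolynomial (Fin 3) ℂ :=
  (s.map fun c => a - C c * b).prod

lemma pencilForm_mul (s : Multiset ℂ) (k a b : MvPolynomial (Fin 3) ℂ) :
    pencilForm s (k * a) (k * b) = k ^ s.card * pencilForm s a b := by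
  induction s using Multiset.induction_on with
  | empty => simp [pencilForm]
  | cons c s ih =>
    simp only [pencilForm, Multiset.map_cons, Multiset.prod_cons, Multiset.card_cons] at ih ⊢
    rw [ih]
    ring

lemma isHomogeneous_of_eq {p : MvPolynomial (Fin 3) ℂ} {m n : ℕ} (hp : p.IsHomogeneous m)
    (h : m = n) : p.IsHomogeneous n :=
  h ▸ hp

lemma isHomogeneous_pencilForm (s : Multiset ℂ) {a b : MvPolynomial (Fin 3) ℂ} {n : ℕ}
    (ha : a.IsHomogeneous n) (hb : b.IsHomogeneous n) :
    (pencilForm s a b).IsHomogeneous (n * s.card) := by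
  induction s using Multiset.induction_on with
  | empty => simpa [pencilForm] using isHomogeneous_one (Fin 3) ℂ
  | cons c s ih =>
    simp only [pencilForm, Multiset.map_cons, Multiset.prod_cons, Multiset.card_cons] at ih ⊢
    rw [mul_add, mul_one, add_comm]
    exact (ha.sub (hb.C_mul c)).mul ih

lemma bind₁_pencilForm (f : Fin 3 → MvPolynomial (Fin 3) ℂ) (s : Multiset ℂ)
    (a b : MvPolynomial (Fin 3) ℂ) :
    bind₁ f (pencilForm s a b) = pencilForm s (bind₁ f a) (bind₁ f b) := by
  simp [pencilForm, map_multiset_prod]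

lemma eval_pencilForm (x : Fin 3 → ℂ) (s : Multiset ℂ) (a b : MvPolynomial (Fin 3) ℂ) :
    eval x (pencilForm s a b) = (s.map fun c => eval x a - c * eval x b).prod := by
  simp [pencilForm, map_multiset_prod]

lemma eval_pencilForm_eq_one {x : Fin 3 → ℂ} (s : Multiset ℂ) {a b : MvPolynomial (Fin 3) ℂ}
    (ha : eval x a = 1) (hb : eval x b = 0) : eval x (pencilForm s a b) = 1 := by
  simp [eval_pencilForm, ha, hb]

lemma eval_pencilForm_ne_zero {x : Fin 3 → ℂ} {s : Multiset ℂ} (hs : 0 ∉ s)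
    {a b : MvPolynomial (Fin 3) ℂ} (ha : eval x a = 0) (hb : eval x b = 1) :
    eval x (pencilForm s a b) ≠ 0 := by
  rw [eval_pencilForm]
  refine Multiset.prod_ne_zero ?_
  simpa [ha, hb] using hs

lemma isRelPrime_of_eval {p q : MvPolynomial (Fin 3) ℂ} (hp : Irreducible p) (x : Fin 3 → ℂ)
    (hpx : eval x p = 0) (hqx : eval x q ≠ 0) : IsRelPrime p q := by
  rw [hp.isRelPrime_iff_not_dvd]
  rintro ⟨r, rfl⟩
  simp [hpx] at hqx

lemma irreducible_X' (i : Fin 3) : Irreducible (X i : MvPolynomial (Fin 3) ℂ) :=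
  (X_prime (i := i)).irreducible

lemma irreducible_X_one_sub_X_two : Irreducible (X 1 - X 2 : MvPolynomial (Fin 3) ℂ) := by
  have h1 : (X 1 - X 2 : MvPolynomial (Fin 3) ℂ).IsHomogeneous 1 :=
    (isHomogeneous_X ℂ 1).sub (isHomogeneous_X ℂ 2)
  have h0 : (X 1 - X 2 : MvPolynomial (Fin 3) ℂ) ≠ 0 :=
    sub_ne_zero.2 fun h => by simpa using X_injective h
  refine irreducible_of_totalDegree_eq_one (h1.totalDegree h0) fun c hc => ?_
  refine isUnit_iff_ne_zero.2 ?_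
  rintro rfl
  exact h0 (MvPolynomial.ext _ _ fun m => by simpa using hc m)

/-! ### The contracting Cremona map and its inverse -/

/-- In the affine chart `x₂ = 1`, with `f = ∏ (x - c)`, this is the map
`(x, y) ↦ (x (y - 1) / (f y), f y / (y - 1))`. -/
noncomputable def contraction (s : Multiset ℂ) (k : ℕ) (hk : s.card = k + 1) (hs : 0 ∉ s) :
    PlaneRationalMap where
  degree := 2 * k + 4
  form := ![X 2 ^ (2 * k + 1) * X 0 * (X 1 - X 2) ^ 2,
    pencilForm s (X 0) (X 2) ^ 2 * X 1 ^ 2,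
    pencilForm s (X 0) (X 2) * X 1 * (X 1 - X 2) * X 2 ^ (k + 1)]
  isHomogeneous := by
    have hX := isHomogeneous_X (σ := Fin 3) ℂ
    have hF : (pencilForm s (X 0) (X 2)).IsHomogeneous (k + 1) := by
      simpa [hk] using isHomogeneous_pencilForm s (hX 0) (hX 2)
    have hS := (hX 1).sub (hX 2)
    intro i
    fin_cases i
    · exact isHomogeneous_of_eq ((((hX 2).pow (2 * k + 1)).mul (hX 0)).mul (hS.pow 2)) (by ring)
    · exact isHomogeneous_of_eq ((hF.pow 2).mul ((hX 1).pow 2)) (by ring)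
    · exact isHomogeneous_of_eq (((hF.mul (hX 1)).mul hS).mul ((hX 2).pow (k + 1))) (by ring)
  isUnit_of_dvd := by
    intro g hg
    have h0 := hg 0
    have h1 := hg 1
    simp only [Matrix.cons_val_zero, Matrix.cons_val_one] at h0 h1
    -- The first two forms are already coprime: each irreducible factor of the first vanishes at a
    -- point where the second does not. For `X 0` this uses `0 ∉ s`.
    refine IsRelPrime.mul_left (IsRelPrime.mul_left ?_ ?_) ?_ h0 h1
    · refine IsRelPrime.pow_left (isRelPrime_of_eval (irreducible_X' 2) ![1, 1, 0] (by simp) ?_)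
      simp [eval_pencilForm_eq_one]
    · refine isRelPrime_of_eval (irreducible_X' 0) ![0, 1, 1] (by simp) ?_
      simp [eval_pencilForm_ne_zero hs]
    · refine IsRelPrime.pow_left
        (isRelPrime_of_eval irreducible_X_one_sub_X_two ![0, 1, 1] (by simp) ?_)
      simp [eval_pencilForm_ne_zero hs]

/-- In the affine chart `x₂ = 1`, with `f = ∏ (x - c)`, this is the map
`(x, y) ↦ (x y, y / (y - f(x y)))`. -/
noncomputable def contractionInv (s : Multiset ℂ) (k : ℕ) (hk : s.card = k + 1) (hs : 0 ∉ s) :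
    PlaneRationalMap where
  degree := 2 * k + 4
  form := ![X 0 * X 1 * (X 1 * X 2 ^ (2 * k + 1) - pencilForm s (X 0 * X 1) (X 2 ^ 2)),
    X 1 * X 2 ^ (2 * k + 3),
    X 2 ^ 2 * (X 1 * X 2 ^ (2 * k + 1) - pencilForm s (X 0 * X 1) (X 2 ^ 2))]
  isHomogeneous := by
    have hX := isHomogeneous_X (σ := Fin 3) ℂ
    have hD : (X 1 * X 2 ^ (2 * k + 1) - pencilForm s (X 0 * X 1) (X 2 ^ 2)).IsHomogeneous
        (2 * k + 2) := by
      refine IsHomogeneous.sub ?_ ?_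
      · exact isHomogeneous_of_eq ((hX 1).mul ((hX 2).pow (2 * k + 1))) (by ring)
      · exact isHomogeneous_of_eq
          (isHomogeneous_pencilForm s ((hX 0).mul (hX 1)) ((hX 2).pow 2)) (by rw [hk]; ring)
    intro i
    fin_cases i
    · exact isHomogeneous_of_eq (((hX 0).mul (hX 1)).mul hD) (by ring)
    · exact isHomogeneous_of_eq ((hX 1).mul ((hX 2).pow (2 * k + 3))) (by ring)
    · exact isHomogeneous_of_eq (((hX 2).pow 2).mul hD) (by ring)
  isUnit_of_dvd := by
    intro g hg
    have h0 := hg 0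
    have h1 := hg 1
    have h2 := hg 2
    simp only [Matrix.cons_val] at h0 h1 h2
    refine IsRelPrime.mul_right (x := g) ?_ ?_ dvd_rfl h1
    · refine IsRelPrime.of_dvd_left (IsRelPrime.symm ?_) h2
      refine isRelPrime_of_eval (irreducible_X' 1) ![0, 0, 1] (by simp) ?_
      simp [eval_pencilForm_ne_zero hs]
    · refine IsRelPrime.of_dvd_left (IsRelPrime.symm (IsRelPrime.pow_left ?_)) h0
      refine isRelPrime_of_eval (irreducible_X' 2) ![1, 1, 0] (by simp) ?_
      simp [eval_pencilForm_eq_one]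

lemma compEqId_contractionInv_contraction (s : Multiset ℂ) (k : ℕ) (hk : s.card = k + 1)
    (hs : 0 ∉ s) : (contractionInv s k hk hs).CompEqId (contraction s k hk hs) := by
  set F := pencilForm s (X 0) (X 2) with hF
  -- `K` is the factor by which (form 0 · form 1, form 2²) exceeds (x₀, x₂): the inverse recovers x
  -- as the product of the two affine coordinates.
  set K : MvPolynomial (Fin 3) ℂ := X 2 ^ (2 * k + 1) * (X 1 - X 2) ^ 2 * F ^ 2 * X 1 ^ 2 with hK
  have hF0 : F ≠ 0 := by
    intro h
    have := eval_pencilForm_eq_one (x := ![1, 0, 0]) s (a := X 0) (b := X 2) (by simp) (by simp)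
    simp [← hF, h] at this
  have hX (i : Fin 3) : (X i : MvPolynomial (Fin 3) ℂ) ≠ 0 := X_ne_zero i
  have hS := irreducible_X_one_sub_X_two.ne_zero
  have hsub : pencilForm s
      (X 2 ^ (2 * k + 1) * X 0 * (X 1 - X 2) ^ 2 * (F ^ 2 * X 1 ^ 2))
      ((F * X 1 * (X 1 - X 2) * X 2 ^ (k + 1)) ^ 2) = K ^ (k + 1) * F := by
    have h0 : X 2 ^ (2 * k + 1) * X 0 * (X 1 - X 2) ^ 2 * (F ^ 2 * X 1 ^ 2) = K * X 0 := by
      rw [hK]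
      ring
    have h2 : (F * X 1 * (X 1 - X 2) * X 2 ^ (k + 1)) ^ 2 = K * X 2 := by
      generalize (X 1 - X 2 : MvPolynomial (Fin 3) ℂ) = S at *
      rw [hK]
      ring
    rw [h0, h2, pencilForm_mul, hk]
  refine ⟨K * (F ^ (2 * k + 3) * X 1 ^ (2 * k + 2) * (X 1 - X 2) ^ (2 * k + 1) *
    X 2 ^ ((k + 1) * (2 * k + 1))) * X 2, by simp [K, hF0, hX, hS], fun i => ?_⟩
  have hsub' : F ^ 2 * X 1 ^ 2 * (F * X 1 * (X 1 - X 2) * X 2 ^ (k + 1)) ^ (2 * k + 1) -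
      K ^ (k + 1) * F = F ^ (2 * k + 3) * X 1 ^ (2 * k + 2) * (X 1 - X 2) ^ (2 * k + 1) *
        X 2 ^ ((k + 1) * (2 * k + 1)) * X 2 := by
    obtain ⟨y, hy⟩ : ∃ y : MvPolynomial (Fin 3) ℂ, y = X 1 := ⟨_, rfl⟩
    obtain ⟨S, hS⟩ : ∃ S : MvPolynomial (Fin 3) ℂ, S = X 1 - X 2 := ⟨_, rfl⟩
    have hz : (X 2 : MvPolynomial (Fin 3) ℂ) = y - S := by rw [hS, hy]; ring
    rw [hK, ← hS, ← hy]
    generalize (X 2 : MvPolynomial (Fin 3) ℂ) = z at hz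
    -- The two terms share all factors but one, y in the first and S in the second, and y - S = z.
    trans F ^ (2 * k + 3) * y ^ (2 * k + 2) * S ^ (2 * k + 1) *
        z ^ ((k + 1) * (2 * k + 1)) * (y - S)
    · clear hz
      ring
    · rw [hz]
  fin_cases i
  · simp only [contraction, contractionInv, Fin.zero_eta, Matrix.cons_val, map_mul, map_sub,
      map_pow, bind₁_X_right, bind₁_pencilForm, ← hF, hsub, hsub']
    generalize (X 1 - X 2 : MvPolynomial (Fin 3) ℂ) = S at *
    rw [hK]
    ring
  · simp only [contraction, contractionInv, Fin.mk_one, Matrix.cons_val, map_mul, map_pow,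
      bind₁_X_right, ← hF]
    generalize (X 1 - X 2 : MvPolynomial (Fin 3) ℂ) = S at *
    rw [hK]
    ring
  · simp only [contraction, contractionInv, Fin.reduceFinMk, Matrix.cons_val, map_mul, map_sub,
      map_pow, bind₁_X_right, bind₁_pencilForm, ← hF, hsub, hsub']
    generalize (X 1 - X 2 : MvPolynomial (Fin 3) ℂ) = S at *
    rw [hK]
    ring

lemma compEqId_contraction_contractionInv (s : Multiset ℂ) (k : ℕ) (hk : s.card = k + 1)
    (hs : 0 ∉ s) : (contraction s k hk hs).CompEqId (contractionInv s k hk hs) := by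
  set F := pencilForm s (X 0 * X 1) (X 2 ^ 2) with hF
  set D := X 1 * X 2 ^ (2 * k + 1) - F with hD
  have hFe : eval ![1, 1, 0] F = 1 := eval_pencilForm_eq_one s (by simp) (by simp)
  have hF0 : F ≠ 0 := fun h => by simp [h] at hFe
  have hD0 : D ≠ 0 := fun h => by
    have h' := congrArg (eval ![1, 1, 0]) h
    simp [hD, hFe] at h'
  have hX (i : Fin 3) : (X i : MvPolynomial (Fin 3) ℂ) ≠ 0 := X_ne_zero i
  have hsub : pencilForm s (X 0 * X 1 * D) (X 2 ^ 2 * D) = D ^ (k + 1) * F := by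
    rw [hF, ← hk, ← pencilForm_mul]
    congr 1 <;> ring
  have hsub' : X 1 * X 2 ^ (2 * k + 3) - X 2 ^ 2 * D = X 2 ^ 2 * F := by
    rw [hD]
    ring
  refine ⟨X 1 * X 2 ^ (4 * k + 6) * D ^ (2 * k + 2) * F ^ 2, by simp [hF0, hX, hD0],
    fun i => ?_⟩
  fin_cases i
  · simp only [contraction, contractionInv, Fin.zero_eta, Matrix.cons_val, map_mul, map_sub,
      map_pow, bind₁_X_right, ← hF, ← hD, hsub']
    clear_value D F
    ring
  · simp only [contraction, contractionInv, Fin.mk_one, Matrix.cons_val, map_mul,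
      map_pow, bind₁_X_right, bind₁_pencilForm, ← hF, ← hD, hsub]
    clear_value D F
    ring
  · simp only [contraction, contractionInv, Fin.reduceFinMk, Matrix.cons_val, map_mul, map_sub,
      map_pow, bind₁_X_right, bind₁_pencilForm, ← hF, ← hD, hsub, hsub']
    clear_value D F
    ring

lemma isCremona_contraction (s : Multiset ℂ) (k : ℕ) (hk : s.card = k + 1) (hs : 0 ∉ s) :
    (contraction s k hk hs).IsCremona :=
  ⟨contractionInv s k hk hs, compEqId_contractionInv_contraction s k hk hs,
    compEqId_contraction_contractionInv s k hk hs⟩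

/-- A Cremona transformation that maps the lines `x₂ = 0`, `x₁ = 0`, `x₁ = x₂`, and `x₀ = c x₂` for
`c ∈ s`, to the points `[1, 0, 0]` and `[0, 1, 0]`. -/
lemma exists_isCremona_contracting (s : Multiset ℂ) (hs0 : s ≠ 0) (hs : 0 ∉ s) :
    ∃ γ : PlaneRationalMap, γ.IsCremona ∧ ∀ x : Fin 3 → ℂ,
      (x 2 = 0 ∨ x 1 = 0 ∨ x 1 = x 2 ∨ ∃ c ∈ s, x 0 = c * x 2) →
      γ.coords x 2 = 0 ∧ (γ.coords x 0 = 0 ∨ γ.coords x 1 = 0) := by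
  obtain ⟨k, hk⟩ := Nat.exists_eq_succ_of_ne_zero (mt Multiset.card_eq_zero.1 hs0)
  refine ⟨contraction s k hk hs, isCremona_contraction s k hk hs, ?_⟩
  rintro x (h | h | h | ⟨c, hc, h⟩)
  · simp [PlaneRationalMap.coords, contraction, h]
  · simp [PlaneRationalMap.coords, contraction, h]
  · simp [PlaneRationalMap.coords, contraction, h]
  · have : eval x (pencilForm s (X 0) (X 2)) = 0 := by
      rw [eval_pencilForm, Multiset.prod_eq_zero_iff, Multiset.mem_map]
      exact ⟨c, hc, by simp [h]⟩
    simp [PlaneRationalMap.coords, contraction, this]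

end Contraction

/-! ### Linear changes of coordinates -/

section LinearChange

open MvPolynomial

/-- The linear forms given by the rows of a matrix. -/
noncomputable def rowForm (M : Matrix (Fin 3) (Fin 3) ℂ) (i : Fin 3) : MvPolynomial (Fin 3) ℂ :=
  ∑ j, C (M i j) * X j

lemma bind₁_rowForm (M : Matrix (Fin 3) (Fin 3) ℂ) (f : Fin 3 → MvPolynomial (Fin 3) ℂ)
    (i : Fin 3) : bind₁ f (rowForm M i) = ∑ j, C (M i j) * f j := by
  simp [rowForm, map_sum]

lemma sum_C_mul_sum_C_mul {M N : Matrix (Fin 3) (Fin 3) ℂ} (h : M * N = 1)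
    (f : Fin 3 → MvPolynomial (Fin 3) ℂ) (i : Fin 3) :
    ∑ j, C (M i j) * ∑ k, C (N j k) * f k = f i := by
  simp_rw [Finset.mul_sum]
  rw [Finset.sum_comm]
  have (k : Fin 3) : ∑ j, C (M i j) * (C (N j k) * f k) = C ((M * N) i k) * f k := by
    simp_rw [← mul_assoc, ← Finset.sum_mul, ← C_mul, ← map_sum, Matrix.mul_apply]
  simp_rw [this, h, Matrix.one_apply]
  simp [apply_ite C, ite_mul]

lemma bind₁_rowForm_bind₁_rowForm {M N : Matrix (Fin 3) (Fin 3) ℂ} (h : M * N = 1)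
    (p : MvPolynomial (Fin 3) ℂ) : bind₁ (rowForm N) (bind₁ (rowForm M) p) = p := by
  rw [bind₁_bind₁]
  have : (fun i => bind₁ (rowForm N) (rowForm M i)) = X := by
    funext i
    rw [bind₁_rowForm]
    exact sum_C_mul_sum_C_mul h X i
  rw [this, bind₁_X_left]
  rfl

namespace PlaneRationalMap

/-- The composition `γ ∘ M` of a rational map with the linear transformation of matrix `M`, where
`N = M⁻¹`. -/
noncomputable def compLinear (γ : PlaneRationalMap) (M N : Matrix (Fin 3) (Fin 3) ℂ)
    (hMN : M * N = 1) : PlaneRationalMap where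
  degree := γ.degree
  form i := bind₁ (rowForm M) (γ.form i)
  isHomogeneous i := by
    have := (γ.isHomogeneous i).aeval (rowForm M) (n := 1) fun j =>
      IsHomogeneous.sum _ _ _ fun k _ => isHomogeneous_C_mul_X _ _
    rwa [one_mul] at this
  isUnit_of_dvd g hg := by
    have h : IsUnit (bind₁ (rowForm N) g) := γ.isUnit_of_dvd _ fun i => by
      simpa [bind₁_rowForm_bind₁_rowForm hMN] using map_dvd (bind₁ (rowForm N)) (hg i)
    simpa [bind₁_rowForm_bind₁_rowForm (mul_eq_one_comm.1 hMN)] using h.map (bind₁ (rowForm M))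

/-- The composition `N ∘ δ` of a rational map with the linear transformation of matrix `N`, where
`M = N⁻¹`. -/
noncomputable def linearComp (δ : PlaneRationalMap) (M N : Matrix (Fin 3) (Fin 3) ℂ)
    (hMN : M * N = 1) : PlaneRationalMap where
  degree := δ.degree
  form i := ∑ j, C (N i j) * δ.form j
  isHomogeneous i := IsHomogeneous.sum _ _ _ fun j _ => (δ.isHomogeneous j).C_mul _
  isUnit_of_dvd g hg := δ.isUnit_of_dvd g fun i => by
    rw [← sum_C_mul_sum_C_mul hMN δ.form i]
    exact Finset.dvd_sum fun j _ => Dvd.dvd.mul_left (hg j) _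

/-- The inverse of γ ∘ M is N ∘ δ, where δ is the inverse of γ. -/
lemma IsCremona.compLinear {γ : PlaneRationalMap} (hγ : γ.IsCremona)
    (M N : Matrix (Fin 3) (Fin 3) ℂ) (hMN : M * N = 1) : (γ.compLinear M N hMN).IsCremona := by
  obtain ⟨δ, ⟨H, hH, hδγ⟩, ⟨H', hH', hγδ⟩⟩ := hγ
  refine ⟨δ.linearComp M N hMN, ⟨bind₁ (rowForm M) H, fun h => hH ?_, fun i => ?_⟩,
    ⟨H', hH', fun i => ?_⟩⟩
  · rw [← bind₁_rowForm_bind₁_rowForm hMN H, h, map_zero]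
  · have (j : Fin 3) : bind₁ (fun i => bind₁ (rowForm M) (γ.form i)) (δ.form j) =
        bind₁ (rowForm M) H * rowForm M j := by
      rw [← bind₁_bind₁, hδγ, map_mul, bind₁_X_right]
    simp only [PlaneRationalMap.compLinear, linearComp, map_sum, map_mul, bind₁_C_right, this]
    simp_rw [mul_left_comm _ (bind₁ (rowForm M) H), ← Finset.mul_sum]
    congr 1
    exact sum_C_mul_sum_C_mul (mul_eq_one_comm.1 hMN) X i
  · have (j : Fin 3) : bind₁ (fun i => ∑ j, C (N i j) * δ.form j) (rowForm M j) = δ.form j := by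
      rw [bind₁_rowForm, sum_C_mul_sum_C_mul hMN]
    simp only [PlaneRationalMap.compLinear, linearComp, bind₁_bind₁, this, hγδ]

lemma coords_compLinear (γ : PlaneRationalMap) (M N : Matrix (Fin 3) (Fin 3) ℂ)
    (hMN : M * N = 1) (x : Fin 3 → ℂ) :
    (γ.compLinear M N hMN).coords x = γ.coords (M.mulVec x) := by
  funext i
  simp only [coords, compLinear, eval, eval₂Hom_bind₁]
  congr 2
  funext j
  simp [rowForm, Matrix.mulVec, dotProduct]

end PlaneRationalMap

end LinearChange

/-! ### From line configurations to normal form -/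

section Lines

open Matrix

lemma finite_image_of_coords {γ : PlaneRationalMap} {Z : Set PPlane}
    (h : ∀ (x : Fin 3 → ℂ) (hx : x ≠ 0), Projectivization.mk ℂ x hx ∈ Z →
      γ.coords x 2 = 0 ∧ (γ.coords x 0 = 0 ∨ γ.coords x 1 = 0)) : (γ.image Z).Finite := by
  have h0 : (![1, 0, 0] : Fin 3 → ℂ) ≠ 0 := fun h => by simpa using congrFun h 0
  have h1 : (![0, 1, 0] : Fin 3 → ℂ) ≠ 0 := fun h => by simpa using congrFun h 1
  refine (Set.toFinite {Projectivization.mk ℂ _ h0, Projectivization.mk ℂ _ h1}).subset ?_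
  rintro _ ⟨x, hx, hγ, hxZ, rfl⟩
  obtain ⟨hx2, hx0 | hx1⟩ := h x hx hxZ
  · refine Or.inr ((Projectivization.mk_eq_mk_iff' ..).2 ⟨γ.coords x 1, ?_⟩)
    ext i
    fin_cases i <;> simp [hx2, hx0]
  · refine Or.inl ((Projectivization.mk_eq_mk_iff' ..).2 ⟨γ.coords x 0, ?_⟩)
    ext i
    fin_cases i <;> simp [hx2, hx1]

/-- Lines given, in a suitable coordinate system, by `x₂ = 0`, `x₁ = 0`, `x₁ = x₂` and
`x₀ = c x₂` for finitely many nonzero `c`, form a Cremona contractible curve. -/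
lemma isCrContractible_of_forms {C : Set PPlane} {n A p : Fin 3 → ℂ}
    (hind : LinearIndependent ℂ ![n, A, p]) (s : Multiset ℂ) (hs0 : s ≠ 0) (hs : 0 ∉ s)
    (h : ∀ (x : Fin 3 → ℂ) (hx : x ≠ 0), Projectivization.mk ℂ x hx ∈ C →
      p ⬝ᵥ x = 0 ∨ A ⬝ᵥ x = 0 ∨ A ⬝ᵥ x = p ⬝ᵥ x ∨ ∃ c ∈ s, n ⬝ᵥ x = c * (p ⬝ᵥ x)) :
    IsCrContractible C := by
  obtain ⟨γ, hγ, hγC⟩ := exists_isCremona_contracting s hs0 hs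
  have hM : IsUnit (Matrix.of ![n, A, p]) :=
    Matrix.linearIndependent_rows_iff_isUnit.1 hind
  obtain ⟨N, hN⟩ := hM.exists_right_inv
  refine ⟨γ.compLinear _ N hN, hγ.compLinear _ N hN, finite_image_of_coords fun x hx hxC => ?_⟩
  rw [γ.coords_compLinear]
  exact hγC _ (h x hx hxC)

/-- Pairing a relation with `v₀` and `v₁` kills the coefficients of `A` and `n`, leaving a multiple
of `p ≠ 0`. -/
lemma linearIndependent_of_dotProduct {v₀ v₁ n A p : Fin 3 → ℂ} (hn0 : n ⬝ᵥ v₀ = 0)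
    (hn1 : n ⬝ᵥ v₁ = 1) (hA0 : A ⬝ᵥ v₀ = 1) (hA1 : A ⬝ᵥ v₁ = 0) (hp0 : p ⬝ᵥ v₀ = 0)
    (hp1 : p ⬝ᵥ v₁ = 0) (hp : p ≠ 0) : LinearIndependent ℂ ![n, A, p] := by
  rw [Fintype.linearIndependent_iff]
  intro g hg
  simp only [Fin.sum_univ_three, Matrix.cons_val] at hg
  have e0 := congrArg (· ⬝ᵥ v₀) hg
  have e1 := congrArg (· ⬝ᵥ v₁) hg
  simp only [add_dotProduct, smul_dotProduct, hn0, hn1, hA0, hA1, hp0, hp1, smul_eq_mul, mul_zero,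
    mul_one, zero_add, add_zero, zero_dotProduct] at e0 e1
  rw [e0, e1] at hg
  have e2 : g 2 = 0 := by simpa [hp] using hg
  intro i
  fin_cases i <;> assumption

/-- The union of two lines that meet at `P₁` and of finitely many lines through a point `P₀`, not
on the former two, is Cremona contractible. -/
lemma isCrContractible_of_pencil (S : Finset PPlane) {A B P₀ P₁ : PPlane} (hAB : A ≠ B)
    (hA0 : ¬ A.orthogonal P₀) (hB0 : ¬ B.orthogonal P₀) (hA1 : A.orthogonal P₁)
    (hB1 : B.orthogonal P₁) (hS : ∀ L ∈ S, L = A ∨ L = B ∨ L.orthogonal P₀) :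
    IsCrContractible {P | ∃ L ∈ S, L.orthogonal P} := by
  classical
  induction P₀ using Projectivization.ind with | h v₀ hv₀ =>
  induction P₁ using Projectivization.ind with | h v₁ hv₁ =>
  obtain ⟨a, ha, ha0, rfl⟩ : ∃ a, ∃ ha : a ≠ 0, a ⬝ᵥ v₀ = 1 ∧ Projectivization.mk ℂ a ha = A := by
    induction A using Projectivization.ind with | h a ha =>
    rw [Projectivization.orthogonal_mk] at hA0
    refine ⟨(a ⬝ᵥ v₀)⁻¹ • a, smul_ne_zero (inv_ne_zero hA0) ha, by simp [hA0], ?_⟩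
    exact (Projectivization.mk_eq_mk_iff' ..).2 ⟨_, rfl⟩
  obtain ⟨b, hb, hb0, rfl⟩ : ∃ a, ∃ ha : a ≠ 0, a ⬝ᵥ v₀ = 1 ∧ Projectivization.mk ℂ a ha = B := by
    induction B using Projectivization.ind with | h a ha =>
    rw [Projectivization.orthogonal_mk] at hB0
    refine ⟨(a ⬝ᵥ v₀)⁻¹ • a, smul_ne_zero (inv_ne_zero hB0) ha, by simp [hB0], ?_⟩
    exact (Projectivization.mk_eq_mk_iff' ..).2 ⟨_, rfl⟩
  rw [Projectivization.orthogonal_mk] at hA1 hB1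
  have hp : a - b ≠ 0 := sub_ne_zero.2 fun h => hAB (by simp [h])
  have hp0 : (a - b) ⬝ᵥ v₀ = 0 := by simp [sub_dotProduct, ha0, hb0]
  have hp1 : (a - b) ⬝ᵥ v₁ = 0 := by simp [sub_dotProduct, hA1, hB1]
  obtain ⟨n, hn0, hn1⟩ : ∃ n : Fin 3 → ℂ, n ⬝ᵥ v₀ = 0 ∧ n ⬝ᵥ v₁ = 1 := by
    obtain ⟨w, hw⟩ : ∃ w : Fin 3 → ℂ, w ⬝ᵥ v₁ ≠ 0 := by
      by_contra! h
      exact hv₁ (dotProduct_eq_zero_iff.1 fun w => by rw [dotProduct_comm]; exact h w)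
    -- Subtracting a multiple of `a` kills the value at `v₀` and keeps that at `v₁`, as `a ⬝ᵥ v₁ =
    -- 0`.
    refine ⟨(w ⬝ᵥ v₁)⁻¹ • (w - (w ⬝ᵥ v₀) • a), ?_, ?_⟩
    · simp [sub_dotProduct, ha0]
    · simp [sub_dotProduct, hA1, hw]
  have hind := linearIndependent_of_dotProduct hn0 hn1 ha0 hA1 hp0 hp1 hp
  have hspan (l : Fin 3 → ℂ) (hl : l ⬝ᵥ v₀ = 0) : ∃ α β : ℂ, l = α • n + β • (a - b) := by
    have := hind.span_eq_top_of_card_eq_finrank (by simp)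
    have hmem : l ∈ Submodule.span ℂ (Set.range ![n, a, a - b]) := this ▸ Submodule.mem_top
    obtain ⟨g, rfl⟩ := (Submodule.mem_span_range_iff_exists_fun ℂ).1 hmem
    simp only [Fin.sum_univ_three, Matrix.cons_val, add_dotProduct, smul_dotProduct, hn0, ha0,
      hp0, smul_eq_mul, mul_zero, mul_one, zero_add, add_zero] at hl
    exact ⟨g 0, g 2, by simp [Fin.sum_univ_three, hl]⟩
  have hcoef (L : PPlane) : ∃ c : ℂ, L.orthogonal (Projectivization.mk ℂ v₀ hv₀) →
      ∀ (x : Fin 3 → ℂ) (hx : x ≠ 0), L.orthogonal (Projectivization.mk ℂ x hx) →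
        (a - b) ⬝ᵥ x = 0 ∨ n ⬝ᵥ x = c * ((a - b) ⬝ᵥ x) := by
    induction L using Projectivization.ind with | h l hl =>
    by_cases hl0 : l ⬝ᵥ v₀ = 0
    · obtain ⟨α, β, rfl⟩ := hspan l hl0
      refine ⟨-β / α, fun _ x hx hlx => ?_⟩
      rw [Projectivization.orthogonal_mk, add_dotProduct, smul_dotProduct, smul_dotProduct,
        smul_eq_mul, smul_eq_mul] at hlx
      rcases eq_or_ne α 0 with rfl | hα
      · have hβ : β ≠ 0 := fun h => hl (by simp [h])
        exact Or.inl (by simpa [hβ] using hlx)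
      · refine Or.inr ?_
        field_simp
        linear_combination hlx
    · exact ⟨0, fun h => absurd h hl0⟩
  choose c hc using hcoef
  -- Replacing n by n - t(a - b) shifts every slope c to c - t, nonzero for this t. The extra slope
  -- 0 only makes the multiset nonempty.
  obtain ⟨t, ht⟩ := Infinite.exists_notMem_finset (insert 0 (S.image c))
  simp only [Finset.mem_insert, Finset.mem_image, not_or, not_exists, not_and] at ht
  have hind' : LinearIndependent ℂ ![n - t • (a - b), a, a - b] :=
    linearIndependent_of_dotProduct
      (by simp only [sub_dotProduct n, smul_dotProduct, hn0, hp0]; simp)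
      (by simp only [sub_dotProduct n, smul_dotProduct, hn1, hp1]; simp) ha0 hA1 hp0 hp1 hp
  refine isCrContractible_of_forms hind' ((insert 0 (S.image c)).val.map (· - t))
    (by simp only [ne_eq, Multiset.map_eq_zero, Finset.val_eq_zero, Finset.insert_ne_empty,
      not_false_eq_true]) ?_ ?_
  · simp only [Multiset.mem_map, Finset.mem_val, Finset.mem_insert, Finset.mem_image, sub_eq_zero]
    rintro ⟨_, rfl | ⟨L, hL, rfl⟩, h⟩
    · exact ht.1 h.symm
    · exact ht.2 L hL h
  · rintro x hx ⟨L, hL, hLx⟩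
    obtain rfl | rfl | hL0 := hS L hL
    · exact Or.inr (Or.inl hLx)
    · rw [Projectivization.orthogonal_mk] at hLx
      exact Or.inr (Or.inr (Or.inl (by rw [sub_dotProduct, hLx, sub_zero])))
    · obtain h | h := hc L hL0 x hx hLx
      · exact Or.inl h
      · refine Or.inr (Or.inr (Or.inr ⟨c L - t, Multiset.mem_map_of_mem _ ?_, ?_⟩))
        · exact Finset.mem_insert_of_mem (Finset.mem_image_of_mem _ hL)
        · rw [sub_dotProduct n, smul_dotProduct, h, smul_eq_mul]
          ring

lemma IsProjLine.eq_of_mem {L M : Set PPlane} (hL : IsProjLine L) (hM : IsProjLine M)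
    {P Q : PPlane} (hPQ : P ≠ Q) (hPL : P ∈ L) (hQL : Q ∈ L) (hPM : P ∈ M) (hQM : Q ∈ M) :
    L = M := by
  obtain ⟨A, rfl⟩ := hL
  obtain ⟨B, rfl⟩ := hM
  have h := Configuration.ofField.eq_or_eq_of_orthogonal (a := A) (b := B) hPL hPM hQL hQM
  rw [h.resolve_right hPQ]

lemma lineMult_eq_card (S : Finset (Set PPlane)) (P : PPlane)
    [DecidablePred (P ∈ · : Set PPlane → Prop)] :
    lineMult S P = (S.filter (P ∈ ·)).card := by
  rw [lineMult, ← Set.ncard_coe_finset]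
  simp

end Lines

theorem mainTheorem2 (d : ℕ) (hd : 3 ≤ d) (S : Finset (Set PPlane))
    (hS : ∀ L ∈ S, IsProjLine L)
    (htype : HasLineType S d ((d - 2) :: 3 :: List.replicate (2 * (d - 3)) 2)) :
    IsCrContractible (⋃ L ∈ S, L) := by
  classical
  obtain ⟨hcard, P, hP, hmult, -⟩ := htype
  obtain ⟨P₀, hP₀⟩ : ∃ Q, Q = P ⟨0, by simp⟩ := ⟨_, rfl⟩
  obtain ⟨P₁, hP₁⟩ : ∃ Q, Q = P ⟨1, by simp⟩ := ⟨_, rfl⟩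
  have hne : P₀ ≠ P₁ := by
    rw [hP₀, hP₁]
    exact hP.ne (by simp)
  have h0 : (S.filter (P₀ ∈ ·)).card = d - 2 := by
    rw [← lineMult_eq_card, hP₀, hmult]
    simp
  have h1 : (S.filter (P₁ ∈ ·)).card = 3 := by
    rw [← lineMult_eq_card, hP₁, hmult]
    simp
  have h2 : (S.filter (P₀ ∉ ·)).card = 2 := by
    have := S.card_filter_add_card_filter_not (P₀ ∈ ·)
    omega
  have h01 : ((S.filter (P₁ ∈ ·)).filter (P₀ ∈ ·)).card ≤ 1 := by
    refine Finset.card_le_one.2 fun L hL M hM => ?_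
    simp only [Finset.mem_filter] at hL hM
    exact (hS L hL.1.1).eq_of_mem (hS M hM.1.1) hne hL.2 hL.1.2 hM.2 hM.1.2
  -- At least 3 - 1 lines through P₁ avoid P₀, and only two lines avoid P₀ at all.
  have h3 : (S.filter (P₁ ∈ ·)).filter (P₀ ∉ ·) = S.filter (P₀ ∉ ·) := by
    refine Finset.eq_of_subset_of_card_le
      (Finset.filter_subset_filter _ (Finset.filter_subset _ _)) ?_
    have := (S.filter (P₁ ∈ ·)).card_filter_add_card_filter_not (P₀ ∈ ·)
    omega
  obtain ⟨LA, LB, hAB, hT⟩ := Finset.card_eq_two.1 h2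
  have hA : LA ∈ (S.filter (P₁ ∈ ·)).filter (P₀ ∉ ·) := by simp [h3, hT]
  have hB : LB ∈ (S.filter (P₁ ∈ ·)).filter (P₀ ∉ ·) := by simp [h3, hT]
  simp only [Finset.mem_filter] at hA hB
  choose! coef hcoef using hS
  have hmem {L : Set PPlane} (hL : L ∈ S) (Q : PPlane) : Q ∈ L ↔ (coef L).orthogonal Q := by
    conv_lhs => rw [hcoef L hL]
    rfl
  convert isCrContractible_of_pencil (S.image coef) (A := coef LA) (B := coef LB) (P₀ := P₀)
    (P₁ := P₁) ?_ ?_ ?_ ?_ ?_ ?_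
  · ext Q
    simp only [Set.mem_iUnion, exists_prop, Finset.exists_mem_image, Set.mem_ofPred_eq]
    exact exists_congr fun L => and_congr_right fun hL => hmem hL Q
  · intro h
    exact hAB (by rw [hcoef LA hA.1.1, hcoef LB hB.1.1, h])
  · exact mt (hmem hA.1.1 _).2 hA.2
  · exact mt (hmem hB.1.1 _).2 hB.2
  · exact (hmem hA.1.1 _).1 hA.1.2
  · exact (hmem hB.1.1 _).1 hB.1.2
  · simp only [Finset.forall_mem_image]
    intro L hL
    by_cases h : P₀ ∈ L
    · exact Or.inr (Or.inr ((hmem hL _).1 h))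
    · have : L ∈ S.filter (P₀ ∉ ·) := Finset.mem_filter.2 ⟨hL, h⟩
      rw [hT, Finset.mem_insert, Finset.mem_singleton] at this
      obtain rfl | rfl := this <;> simp
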